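/- The double series below, whose terms are all positive, converges (hence converges unconditionally, and in particular as an iterated sum), and $$\sum_{n=0}^{\infty}\sum_{k=1}^{\infty}\frac{1}{n!\,k!}\,\frac{1}{n+k}\,\frac{\Gamma(n+k)^3}{\Gamma(2n+2k)} =-\frac{41}{24}\,\zeta(3)-\frac{4\pi}{3}\,\mathrm{Cl}_2\!\left(\frac{\pi}{3}\right)+\frac{\pi^2}{4}\log 2+2\pi G.$$ Here $\Gamma$ is the gamma function, $\zeta$ is the Riemann zeta function (so $\zeta(3)=\sum_{n\ge 1} n^{-3}$), $\mathrm{Cl}_2(\theta)=\sum_{k=1}^{\infty}\frac{\sin(k\theta)}{k^2}$ is Clausen's function, and $G=\sum_{n=0}^{\infty}\frac{(-1)^n}{(2n+1)^2}$ is Catalan's constant. -/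

import Mathlib

open scoped Nat

/-- Clausen's function `Cl₂(θ) = ∑_{k ≥ 1} sin(kθ) / k²`
(absolutely convergent for every real `θ`). -/
noncomputable def clausenTwo (θ : ℝ) : ℝ :=
  ∑' k : ℕ+, Real.sin ((k : ℝ) * θ) / (k : ℝ) ^ 2

/-- Catalan's constant `G = ∑_{n ≥ 0} (-1)^n / (2n+1)² = 0.915966…`. -/
noncomputable def catalanConstant : ℝ :=
  ∑' n : ℕ, (-1 : ℝ) ^ n / (2 * (n : ℝ) + 1) ^ 2

/-!
Summing over the diagonal `n + k = N`, where `∑ 1 / (n! k!) = (2 ^ N - 1) / N!`, turns the double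
series into the single series `2 ∑ (2 ^ N - 1) / (N ^ 3 * centralBinom N)`. So it is enough to
evaluate `∑ (2 sin θ) ^ (2 N) / (N ^ 3 * centralBinom N)` at `θ = π / 6` and at `θ = π / 4`, where
`(2 sin θ) ^ 2` is `1` and `2`. All terms being nonnegative, no other condition is needed for
unconditional summability.

The series with `1 / N`, `1 / N ^ 2`, `1 / N ^ 3` arise from each other by integration
against `2 cot θ`. The recursion for `4 ^ N / (N * centralBinom N)` says that the first of them is `2 θ tan θ`
(`sin_mul_cos_mul_arcsinSeries`); hence the second is `2 θ ^ 2` (the expansion of `arcsin ^ 2`,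
`sin_sq_mul_arcsinSeries`), and the third is `4 ∫₀^θ u ^ 2 cot u`
(`hasSum_four_mul_sin_sq_pow_div`).

That integral is `θ ^ 2 log (2 sin θ) + θ Cl₂(2 θ) + (∑ cos (2 k θ) / k ^ 3 - ζ(3)) / 2`
(`integral_cos_mul_div_sinc`). To see this, write `cot u` as `2 ∑_{k < n} sin (2 k u)` plus the
remainder `cos ((2 n - 1) u) / sin u`, whose contribution tends to `0` by the Riemann–Lebesgue
lemma, and integrate `2 u ^ 2 sin (2 k u)` in closed form. The identity obtained in the limit shows
that `∑ cos (2 k θ) / k` converges, since everything else in it does, and then Abel's limit theorem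
identifies its value as `-log (2 sin θ)`.

At the two angles the cosine sums are rational multiples of `ζ(3)`, because `cos (k π / 3)` and
`cos (k π / 2)` are combinations of indicators of `d ∣ k`, and `Cl₂(π / 2)` is Catalan's constant.
-/

/-! ### Power series with bounded coefficients -/

theorem hasDerivAt_tsum_mul_pow {a : ℕ → ℝ} {M : ℝ} (ha : ∀ n, |a n| ≤ M) {y : ℝ}
    (hy : |y| < 1) :
    HasDerivAt (fun x => ∑' n, a n * x ^ n) (∑' n, a n * (n * y ^ (n - 1))) y := by
  obtain ⟨r, hyr, hr1⟩ := exists_between hy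
  have hr0 : 0 ≤ r := (abs_nonneg y).trans hyr.le
  have hM : 0 ≤ M := (abs_nonneg _).trans (ha 0)
  have hu : Summable fun n : ℕ => M * (n * r ^ (n - 1)) := by
    refine Summable.mul_left _ ?_
    rw [← summable_nat_add_iff 1]
    have h1 := summable_pow_mul_geometric_of_norm_lt_one 1
      (show ‖r‖ < 1 by rwa [Real.norm_of_nonneg hr0])
    have h0 := summable_geometric_of_lt_one hr0 hr1
    refine (h1.add h0).congr fun n => ?_
    simp only [Nat.add_sub_cancel]
    push_cast
    ring
  refine hasDerivAt_tsum_of_isPreconnected (g := fun n x => a n * x ^ n)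
    (g' := fun n x => a n * (n * x ^ (n - 1))) (y₀ := 0) hu Metric.isOpen_ball
    ((convex_ball (0 : ℝ) r).isPreconnected) ?_ ?_ ?_ ?_ ?_
  · intro n x _
    exact (hasDerivAt_pow n x).const_mul (a n)
  · intro n x hx
    have hx' : |x| ≤ r := by simpa using (Metric.mem_ball.1 hx).le
    rw [Real.norm_eq_abs, abs_mul, abs_mul, abs_pow, Nat.abs_cast]
    gcongr
    exact ha n
  · simpa using hyr.trans_le' (abs_nonneg y)
  · exact summable_of_ne_finset_zero (s := {0}) fun n hn => by
      simp [show n ≠ 0 by simpa using hn]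
  · simpa using hyr

theorem summable_mul_pow {a : ℕ → ℝ} {M : ℝ} (ha : ∀ n, |a n| ≤ M) {y : ℝ} (hy : |y| < 1) :
    Summable fun n => a n * y ^ n := by
  refine Summable.of_norm_bounded ((summable_geometric_of_lt_one (abs_nonneg y) hy).mul_left M) ?_
  intro n
  rw [Real.norm_eq_abs, abs_mul, abs_pow]
  gcongr
  exact ha n

theorem summable_mul_nat_mul_pow {a : ℕ → ℝ} {M : ℝ} (ha : ∀ n, |a n| ≤ M) {y : ℝ}
    (hy : |y| < 1) :
    Summable fun n : ℕ => a n * (n * y ^ n) := by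
  have h1 := summable_pow_mul_geometric_of_norm_lt_one 1
      (show ‖|y|‖ < 1 by rwa [Real.norm_of_nonneg (abs_nonneg y)])
  refine Summable.of_norm_bounded (h1.mul_left M) ?_
  intro n
  rw [Real.norm_eq_abs, abs_mul, abs_mul, abs_pow, Nat.abs_cast, pow_one]
  gcongr
  exact ha n

/-! ### Central binomial series and the integral of `u ^ 2 cot u` -/

/-- The coefficients `4ᴺ / (N * centralBinom N)` with `N = n + 1`, that is, those of
`2 * arcsin x * x / √(1 - x²)` as a power series in `x²`, up to a shift of the index. -/
noncomputable def arcsinCoeff (n : ℕ) : ℝ :=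
  4 ^ (n + 1) / ((n + 1) * (Nat.centralBinom (n + 1) : ℝ))

theorem arcsinCoeff_zero : arcsinCoeff 0 = 2 := by
  norm_num [arcsinCoeff, Nat.centralBinom]

theorem arcsinCoeff_succ (n : ℕ) :
    (2 * n + 3) * arcsinCoeff (n + 1) = (2 * n + 2) * arcsinCoeff n := by
  have h := Nat.succ_mul_centralBinom_succ (n + 1)
  have h' : ((n : ℝ) + 2) * (Nat.centralBinom (n + 2) : ℝ)
      = 2 * (2 * (n + 1) + 1) * (Nat.centralBinom (n + 1) : ℝ) := by exact_mod_cast h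
  have h0 : (Nat.centralBinom (n + 1) : ℝ) ≠ 0 := by
    exact_mod_cast Nat.centralBinom_ne_zero (n + 1)
  have h1 : (n : ℝ) + 1 ≠ 0 := by positivity
  have h3 : (2 * (n : ℝ) + 3) ≠ 0 := by positivity
  unfold arcsinCoeff
  push_cast
  rw [show (n : ℝ) + 1 + 1 = n + 2 by ring, h', pow_succ 4 (n + 1)]
  field_simp
  ring

theorem arcsinCoeff_nonneg (n : ℕ) : 0 ≤ arcsinCoeff n := by unfold arcsinCoeff; positivity

theorem abs_arcsinCoeff_le (n : ℕ) : |arcsinCoeff n| ≤ 2 := by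
  rw [abs_of_nonneg (arcsinCoeff_nonneg n)]
  induction n with
  | zero => exact arcsinCoeff_zero.le
  | succ n ih =>
    have := arcsinCoeff_succ n
    have := arcsinCoeff_nonneg (n + 1)
    have hn : (0 : ℝ) ≤ n := n.cast_nonneg
    nlinarith

theorem abs_arcsinCoeff_div_le (j n : ℕ) : |arcsinCoeff n / ((n : ℝ) + 1) ^ j| ≤ 2 := by
  rw [abs_div, abs_of_nonneg (show 0 ≤ ((n : ℝ) + 1) ^ j by positivity)]
  refine (div_le_self (abs_nonneg _) ?_).trans (abs_arcsinCoeff_le n)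
  exact one_le_pow₀ (by linarith [(n.cast_nonneg : (0 : ℝ) ≤ n)])

/-- The power series `∑ arcsinCoeff n / (n + 1) ^ j * y ^ n`. With `y = x ^ 2`, multiplication
by `y` gives `∑ (2 x) ^ (2 N) / (N ^ (j + 1) * centralBinom N)` over `N ≥ 1`. -/
noncomputable def arcsinSeries (j : ℕ) (y : ℝ) : ℝ :=
  ∑' n : ℕ, arcsinCoeff n / ((n : ℝ) + 1) ^ j * y ^ n

theorem hasDerivAt_mul_arcsinSeries_succ (j : ℕ) {y : ℝ} (hy : |y| < 1) :
    HasDerivAt (fun x => x * arcsinSeries (j + 1) x) (arcsinSeries j y) y := by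
  have h := hasDerivAt_tsum_mul_pow (abs_arcsinCoeff_div_le (j + 1)) hy
  have h1 := (hasDerivAt_id y).mul h
  refine h1.congr_deriv ?_
  simp only [id, one_mul]
  rw [← tsum_mul_left, ← Summable.tsum_add (summable_mul_pow (abs_arcsinCoeff_div_le (j + 1)) hy)]
  · refine tsum_congr fun n => ?_
    have : (n : ℝ) + 1 ≠ 0 := by positivity
    rcases n with _ | n
    · simp
    · rw [Nat.add_sub_cancel]
      field_simp
      ring
  · refine (summable_mul_nat_mul_pow (abs_arcsinCoeff_div_le (j + 1)) hy).congr fun n => ?_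
    rcases n with _ | n
    · simp
    · rw [Nat.add_sub_cancel]
      ring

/-- The recursion for the coefficients, as a differential equation for `arcsinSeries 0`. -/
theorem hasDerivAt_arcsinSeries_zero {y : ℝ} (hy : |y| < 1) :
    ∃ d, HasDerivAt (arcsinSeries 0) d y ∧
      (1 - 2 * y) * arcsinSeries 0 y + 2 * y * (1 - y) * d = 2 := by
  have h := hasDerivAt_tsum_mul_pow (abs_arcsinCoeff_div_le 0) hy
  refine ⟨_, h, ?_⟩
  have s0 := (summable_mul_pow abs_arcsinCoeff_le hy)
  have s1 := (summable_mul_nat_mul_pow abs_arcsinCoeff_le hy)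
  have e1 : y * ∑' n : ℕ, arcsinCoeff n / ((n : ℝ) + 1) ^ 0 * (n * y ^ (n - 1))
      = ∑' n : ℕ, arcsinCoeff n * (n * y ^ n) := by
    rw [← tsum_mul_left]
    refine tsum_congr fun n => ?_
    rcases n with _ | n
    · simp
    · rw [Nat.add_sub_cancel]
      ring
  have e0 : arcsinSeries 0 y = ∑' n : ℕ, arcsinCoeff n * y ^ n := by simp [arcsinSeries]
  -- Split off the constant term `arcsinCoeff 0 = 2` of `∑ (2 n + 1) * arcsinCoeff n * y ^ n`; by
  -- the recursion, the rest is `2 y ∑ (n + 1) * arcsinCoeff n * y ^ n`.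
  have hA := (s0.add (s1.mul_left 2)).tsum_eq_zero_add
  have hB : ∑' n : ℕ, (arcsinCoeff (n + 1) * y ^ (n + 1)
        + 2 * (arcsinCoeff (n + 1) * (((n + 1 : ℕ) : ℝ) * y ^ (n + 1))))
      = 2 * y * ∑' n : ℕ, (arcsinCoeff n * y ^ n + arcsinCoeff n * (n * y ^ n)) := by
    rw [← tsum_mul_left]
    refine tsum_congr fun n => ?_
    have := arcsinCoeff_succ n
    push_cast
    linear_combination y ^ (n + 1) * this
  rw [hB, Summable.tsum_add s0 s1, Summable.tsum_add s0 (s1.mul_left 2), tsum_mul_left,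
    arcsinCoeff_zero] at hA
  simp only [Nat.cast_zero, pow_zero] at hA
  rw [e0]
  linear_combination hA + 2 * (1 - y) * e1

theorem sin_sq_lt_one {θ : ℝ} (hθ : |θ| < Real.pi / 2) : |Real.sin θ ^ 2| < 1 := by
  have := Real.cos_pos_of_mem_Ioo (abs_lt.1 hθ)
  rw [abs_of_nonneg (sq_nonneg _)]
  nlinarith [Real.sin_sq_add_cos_sq θ]

theorem hasDerivAt_sin_sq (θ : ℝ) :
    HasDerivAt (fun x => Real.sin x ^ 2) (2 * Real.sin θ * Real.cos θ) θ := by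
  exact ((Real.hasDerivAt_sin θ).pow 2).congr_deriv (by norm_num)

theorem abs_lt_of_mem_uIcc_zero {θ b x : ℝ} (hθ : |θ| < b) (hx : x ∈ Set.uIcc 0 θ) :
    |x| < b := by
  have := Set.abs_sub_left_of_mem_uIcc hx
  simp only [sub_zero] at this
  exact this.trans_lt hθ

/-- The differential equation for `arcsinSeries 0` says that the left side has derivative `2`. -/
theorem sin_mul_cos_mul_arcsinSeries {θ : ℝ} (hθ : |θ| < Real.pi / 2) :
    Real.sin θ * Real.cos θ * arcsinSeries 0 (Real.sin θ ^ 2) = 2 * θ := by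
  have key : ∀ x ∈ Set.uIcc 0 θ, HasDerivAt
      (fun x => Real.sin x * Real.cos x * arcsinSeries 0 (Real.sin x ^ 2)) 2 x := by
    intro x hx
    obtain ⟨d, hd, he⟩ := hasDerivAt_arcsinSeries_zero
      (sin_sq_lt_one (abs_lt_of_mem_uIcc_zero hθ hx))
    have h1 := ((Real.hasDerivAt_sin x).mul (Real.hasDerivAt_cos x)).mul
      (hd.comp x (hasDerivAt_sin_sq x))
    refine h1.congr_deriv ?_
    simp only [Function.comp, Pi.mul_apply]
    have hc := Real.cos_sq' x
    linear_combination he + (arcsinSeries 0 (Real.sin x ^ 2) + 2 * Real.sin x ^ 2 * d) * hc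
  have := intervalIntegral.integral_eq_sub_of_hasDerivAt key intervalIntegrable_const
  simp at this
  linarith

/-- The classical expansion `∑ (2 x) ^ (2 N) / (N ^ 2 * centralBinom N) = 2 * arcsin x ^ 2`. -/
theorem sin_sq_mul_arcsinSeries {θ : ℝ} (hθ : |θ| < Real.pi / 2) :
    Real.sin θ ^ 2 * arcsinSeries 1 (Real.sin θ ^ 2) = 2 * θ ^ 2 := by
  have key : ∀ x ∈ Set.uIcc 0 θ, HasDerivAt
      (fun x => Real.sin x ^ 2 * arcsinSeries 1 (Real.sin x ^ 2)) (4 * x) x := by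
    intro x hx
    have hx' := abs_lt_of_mem_uIcc_zero hθ hx
    have h1 := (hasDerivAt_mul_arcsinSeries_succ 0 (sin_sq_lt_one hx')).comp x (hasDerivAt_sin_sq x)
    refine h1.congr_deriv ?_
    linear_combination 2 * sin_mul_cos_mul_arcsinSeries hx'
  have := intervalIntegral.integral_eq_sub_of_hasDerivAt key
    (Continuous.intervalIntegrable (by fun_prop) _ _)
  rw [intervalIntegral.integral_const_mul, integral_id] at this
  simp at this
  linarith

/-- The continuous extension `u ↦ u / sinc u` of `u ↦ u ^ 2 / sin u`; at `0` both sides are `0`. -/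
theorem div_sinc (u : ℝ) : u / Real.sinc u = u ^ 2 / Real.sin u := by
  rcases eq_or_ne u 0 with rfl | h
  · simp
  · rw [Real.sinc_of_ne_zero h]
    field_simp

theorem continuousOn_div_sinc {θ : ℝ} (hθ : |θ| < Real.pi) :
    ContinuousOn (fun u : ℝ => u / Real.sinc u) (Set.uIcc 0 θ) := by
  refine continuousOn_id.div Real.continuous_sinc.continuousOn fun x hx => ?_
  have hx' := abs_lt_of_mem_uIcc_zero hθ hx
  rcases eq_or_ne x 0 with rfl | h
  · simp
  · rw [Real.sinc_of_ne_zero h]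
    refine div_ne_zero (fun h0 => h ?_) h
    exact (Real.sin_eq_zero_iff_of_lt_of_lt (abs_lt.1 hx').1 (abs_lt.1 hx').2).1 h0

/-- Integrating the `arcsin ^ 2` series once more gives the integral of `4 u ^ 2 cot u`, the
integrand being written as `cos u * (u / sinc u)` so that it is continuous at `0`. -/
theorem sin_sq_mul_arcsinSeries_two {θ : ℝ} (hθ : |θ| < Real.pi / 2) :
    Real.sin θ ^ 2 * arcsinSeries 2 (Real.sin θ ^ 2)
      = 4 * ∫ u in (0 : ℝ)..θ, Real.cos u * (u / Real.sinc u) := by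
  have key : ∀ x ∈ Set.uIcc 0 θ, HasDerivAt
      (fun x => Real.sin x ^ 2 * arcsinSeries 2 (Real.sin x ^ 2))
      (4 * (Real.cos x * (x / Real.sinc x))) x := by
    intro x hx
    have hx' := abs_lt_of_mem_uIcc_zero hθ hx
    have h1 := (hasDerivAt_mul_arcsinSeries_succ 1 (sin_sq_lt_one hx')).comp x (hasDerivAt_sin_sq x)
    refine h1.congr_deriv ?_
    rw [div_sinc]
    have h2 := sin_sq_mul_arcsinSeries hx'
    rcases eq_or_ne (Real.sin x) 0 with h | h
    · simp [h]
    · field_simp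
      linear_combination 2 * Real.cos x * h2
  have hc : ContinuousOn (fun x : ℝ => 4 * (Real.cos x * (x / Real.sinc x))) (Set.uIcc 0 θ) :=
    continuousOn_const.mul (Real.continuous_cos.continuousOn.mul
      (continuousOn_div_sinc (hθ.trans (by linarith [Real.pi_pos]))))
  have := intervalIntegral.integral_eq_sub_of_hasDerivAt key hc.intervalIntegrable
  rw [intervalIntegral.integral_const_mul] at this
  simp only [Real.sin_zero, ne_eq, OfNat.ofNat_ne_zero, not_false_eq_true, zero_pow, zero_mul,
    sub_zero] at this
  exact this.symm

/-- The sum `∑ (2 sin θ) ^ (2 N) / (N ^ 3 * centralBinom N)` over `N = n + 1`. -/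
theorem hasSum_four_mul_sin_sq_pow_div {θ : ℝ} (hθ : |θ| < Real.pi / 2) :
    HasSum (fun n : ℕ => (4 * Real.sin θ ^ 2) ^ (n + 1) /
        (((n : ℝ) + 1) ^ 3 * (Nat.centralBinom (n + 1) : ℝ)))
      (4 * ∫ u in (0 : ℝ)..θ, Real.cos u * (u / Real.sinc u)) := by
  rw [← sin_sq_mul_arcsinSeries_two hθ]
  refine ((summable_mul_pow (abs_arcsinCoeff_div_le 2) (sin_sq_lt_one hθ)).hasSum.mul_left
    (Real.sin θ ^ 2)).congr_fun fun n => ?_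
  have h1 : (n : ℝ) + 1 ≠ 0 := by positivity
  have h0 : (Nat.centralBinom (n + 1) : ℝ) ≠ 0 := by
    exact_mod_cast Nat.centralBinom_ne_zero (n + 1)
  unfold arcsinCoeff
  rw [mul_pow, pow_succ' (Real.sin θ ^ 2)]
  field_simp

/-! ### Fourier evaluation of the integral -/

section

open Filter Topology

/-- Dirichlet's kernel for the conjugate series. -/
theorem two_mul_sum_sin_mul_sin (u : ℝ) (n : ℕ) :
    (∑ k ∈ Finset.range n, 2 * Real.sin (2 * k * u)) * Real.sin u
      = Real.cos u - Real.cos ((2 * n - 1) * u) := by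
  induction n with
  | zero => simp
  | succ n ih =>
    rw [Finset.sum_range_succ, add_mul, ih]
    push_cast
    rw [show (2 * (n : ℝ) - 1) * u = 2 * n * u - u by ring,
      show (2 * ((n : ℝ) + 1) - 1) * u = 2 * n * u + u by ring, Real.cos_sub, Real.cos_add]
    ring

/-- For `k = 0` both sides vanish, by the convention for division by zero. -/
theorem integral_two_mul_sq_mul_sin (θ : ℝ) (k : ℕ) :
    ∫ u in (0 : ℝ)..θ, 2 * u ^ 2 * Real.sin (2 * k * u)
      = -(θ ^ 2 * (Real.cos (k * (2 * θ)) / k)) + θ * (Real.sin (k * (2 * θ)) / k ^ 2)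
        + (Real.cos (k * (2 * θ)) / k ^ 3 - 1 / k ^ 3) / 2 := by
  rcases eq_or_ne k 0 with rfl | hk
  · simp
  have hk' : (k : ℝ) ≠ 0 := by exact_mod_cast hk
  have key : ∀ x ∈ Set.uIcc 0 θ, HasDerivAt
      (fun u : ℝ => -(u ^ 2 * (Real.cos (k * (2 * u)) / k)) + u * (Real.sin (k * (2 * u)) / k ^ 2)
        + (Real.cos (k * (2 * u)) / k ^ 3 - 1 / k ^ 3) / 2)
      (2 * x ^ 2 * Real.sin (2 * k * x)) x := by
    intro x _
    have hl : HasDerivAt (fun u : ℝ => (k : ℝ) * (2 * u)) (k * 2) x := by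
      simpa using ((hasDerivAt_id x).const_mul 2).const_mul (k : ℝ)
    have hs := hl.sin
    have hc := hl.cos
    have h := (((hasDerivAt_pow 2 x).mul (hc.div_const (k : ℝ))).neg.add
      ((hasDerivAt_id x).mul (hs.div_const ((k : ℝ) ^ 2)))).add
      (((hc.div_const ((k : ℝ) ^ 3)).sub_const (1 / (k : ℝ) ^ 3)).div_const 2)
    refine h.congr_deriv ?_
    simp only [id]
    rw [show 2 * (k : ℝ) * x = k * (2 * x) by ring]
    field_simp
    ring
  have := intervalIntegral.integral_eq_sub_of_hasDerivAt key
    (Continuous.intervalIntegrable (by fun_prop) _ _)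
  rw [this]
  simp

/-- A case of the Riemann–Lebesgue lemma, for the frequencies in Dirichlet's kernel. -/
theorem tendsto_integral_cos_mul_of_continuousOn {θ : ℝ} {g : ℝ → ℝ} (hθ : 0 ≤ θ)
    (hg : ContinuousOn g (Set.uIcc 0 θ)) :
    Tendsto (fun n : ℕ => ∫ u in (0 : ℝ)..θ, Real.cos ((2 * n - 1) * u) * g u) atTop (𝓝 0) := by
  have hRL := Real.tendsto_integral_exp_smul_cocompact
    ((Set.Ioc 0 θ).indicator fun u => (g u : ℂ))
  have hw : Tendsto (fun n : ℕ => (2 * (n : ℝ) - 1) / (2 * Real.pi)) atTop (cocompact ℝ) := by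
    refine Tendsto.mono_right ?_ atTop_le_cocompact
    refine Tendsto.atTop_div_const (by positivity) (tendsto_atTop_add_const_right _ _ ?_)
    exact tendsto_natCast_atTop_atTop.const_mul_atTop two_pos
  have h := (Complex.continuous_re.tendsto 0).comp (hRL.comp hw)
  rw [Complex.zero_re] at h
  refine h.congr fun n => ?_
  have hgi : MeasureTheory.IntegrableOn g (Set.Ioc 0 θ) := by
    rw [← intervalIntegrable_iff_integrableOn_Ioc_of_le hθ]
    exact hg.intervalIntegrable
  have hind : ∀ v : ℝ, Real.fourierChar (-(v * ((2 * (n : ℝ) - 1) / (2 * Real.pi)))) •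
      (Set.Ioc 0 θ).indicator (fun u => (g u : ℂ)) v
      = (Set.Ioc 0 θ).indicator (fun u => Complex.exp (((-((2 * n - 1) * u) : ℝ) : ℂ) * Complex.I)
          * (g u : ℂ)) v := by
    intro v
    by_cases hv : v ∈ Set.Ioc 0 θ
    · rw [Set.indicator_of_mem hv, Set.indicator_of_mem hv, Circle.smul_def,
        Real.fourierChar_apply, smul_eq_mul]
      congr 4
      field_simp
    · rw [Set.indicator_of_notMem hv, Set.indicator_of_notMem hv, smul_zero]
  simp only [Function.comp_apply, hind]
  rw [MeasureTheory.integral_indicator measurableSet_Ioc, ← RCLike.re_eq_complex_re, ← integral_re,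
    intervalIntegral.integral_of_le hθ]
  · refine MeasureTheory.integral_congr_ae (Eventually.of_forall fun u => ?_)
    simp only [RCLike.re_eq_complex_re]
    rw [Complex.re_mul_ofReal, Complex.exp_ofReal_mul_I_re, Real.cos_neg]
  · refine hgi.ofReal.bdd_mul (c := 1) (Continuous.aestronglyMeasurable (by fun_prop)) ?_
    exact Eventually.of_forall fun u => (Complex.norm_exp_ofReal_mul_I _).le

/-- If `∑ cos (k t) / k` converges, then by Abel's limit theorem its sum is the limit of
`-log |1 - x exp (i t)|` as `x` tends to `1` from below. -/
theorem eq_neg_log_of_tendsto_sum_cos_div {t l : ℝ} (h0 : 0 < t) (h2 : t < 2 * Real.pi)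
    (h : Tendsto (fun n => ∑ k ∈ Finset.range n, Real.cos (k * t) / k) atTop (𝓝 l)) :
    l = -Real.log (2 * Real.sin (t / 2)) := by
  have habel := Real.tendsto_tsum_powerSeries_nhdsWithin_lt h
  refine tendsto_nhds_unique habel ?_
  have hpos : 0 < 2 * Real.sin (t / 2) :=
    mul_pos two_pos (Real.sin_pos_of_pos_of_lt_pi (by linarith) (by linarith))
  have hnorm : ‖1 - (1 : ℝ) * Complex.exp (Complex.I * t)‖ = 2 * Real.sin (t / 2) := by
    rw [Complex.ofReal_one, one_mul, norm_sub_rev, Complex.norm_exp_I_mul_ofReal_sub_one,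
      Real.norm_of_nonneg hpos.le]
  have hc : Tendsto (fun x : ℝ => -Real.log ‖1 - (x : ℂ) * Complex.exp (Complex.I * t)‖)
      (𝓝[<] 1) (𝓝 (-Real.log (2 * Real.sin (t / 2)))) := by
    rw [← hnorm]
    have hcont : Continuous fun x : ℝ => ‖1 - (x : ℂ) * Complex.exp (Complex.I * t)‖ := by
      fun_prop
    refine Tendsto.mono_left ?_ nhdsWithin_le_nhds
    exact ((hcont.tendsto 1).log (by rw [hnorm]; exact hpos.ne')).neg
  refine hc.congr' ?_
  have hmem : Set.Ioo (0 : ℝ) 1 ∈ 𝓝[<] (1 : ℝ) := Ioo_mem_nhdsLT zero_lt_one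
  filter_upwards [hmem] with x hx
  have hz : ‖(x : ℂ) * Complex.exp (Complex.I * t)‖ < 1 := by
    rw [norm_mul, Complex.norm_exp_I_mul_ofReal, mul_one, Complex.norm_real,
      Real.norm_of_nonneg hx.1.le]
    exact hx.2
  have hs := Complex.hasSum_re (Complex.hasSum_taylorSeries_neg_log hz)
  rw [Complex.neg_re, Complex.log_re] at hs
  rw [← hs.tsum_eq]
  refine tsum_congr fun k => ?_
  rw [Complex.div_natCast_re, mul_pow, ← Complex.ofReal_pow, Complex.re_ofReal_mul,
    ← Complex.exp_nat_mul, show (k : ℂ) * (Complex.I * t) = ((k * t : ℝ) : ℂ) * Complex.I by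
      push_cast; ring, Complex.exp_ofReal_mul_I_re]
  ring

theorem summable_div_nat_pow_of_abs_le_one {f : ℕ → ℝ} (hf : ∀ k, |f k| ≤ 1) {p : ℕ}
    (hp : 1 < p) :
    Summable fun k : ℕ => f k / (k : ℝ) ^ p := by
  refine Summable.of_norm_bounded (Real.summable_one_div_nat_pow.2 hp) fun k => ?_
  rw [Real.norm_eq_abs, abs_div, abs_of_nonneg (show (0 : ℝ) ≤ (k : ℝ) ^ p by positivity)]
  gcongr
  exact hf k

/-- The integral of `u ^ 2 cot u` in closed form. The terms `k = 0` of the three series are `0`. -/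
theorem integral_cos_mul_div_sinc {θ : ℝ} (h0 : 0 < θ) (hπ : θ < Real.pi) :
    ∫ u in (0 : ℝ)..θ, Real.cos u * (u / Real.sinc u)
      = θ ^ 2 * Real.log (2 * Real.sin θ) + θ * ∑' k : ℕ, Real.sin (k * (2 * θ)) / (k : ℝ) ^ 2
        + (∑' k : ℕ, Real.cos (k * (2 * θ)) / (k : ℝ) ^ 3 - ∑' k : ℕ, 1 / (k : ℝ) ^ 3) / 2 := by
  have habs : |θ| < Real.pi := by rwa [abs_of_pos h0]
  have hg := continuousOn_div_sinc habs
  set I := ∫ u in (0 : ℝ)..θ, Real.cos u * (u / Real.sinc u) with hI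
  have hint : ∀ n : ℕ, ∑ k ∈ Finset.range n, (∫ u in (0 : ℝ)..θ, 2 * u ^ 2 * Real.sin (2 * k * u))
      = I - ∫ u in (0 : ℝ)..θ, Real.cos ((2 * n - 1) * u) * (u / Real.sinc u) := by
    intro n
    rw [← intervalIntegral.integral_finsetSum, hI, ← intervalIntegral.integral_sub]
    · refine intervalIntegral.integral_congr fun u hu => ?_
      have hD := two_mul_sum_sin_mul_sin u n
      rw [← sub_mul, ← hD, div_sinc]
      rcases eq_or_ne (Real.sin u) 0 with h | h
      · have hu' := abs_lt.1 (abs_lt_of_mem_uIcc_zero habs hu)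
        simp [(Real.sin_eq_zero_iff_of_lt_of_lt hu'.1 hu'.2).1 h]
      · rw [mul_assoc, mul_div_cancel₀ _ h, Finset.sum_mul]
        refine Finset.sum_congr rfl fun k _ => by ring
    · exact (Real.continuous_cos.continuousOn.mul hg).intervalIntegrable
    · exact ContinuousOn.intervalIntegrable ((Continuous.continuousOn (by fun_prop)).mul hg)
    · exact fun k _ => Continuous.intervalIntegrable (by fun_prop) _ _
  have hlim : Tendsto (fun n : ℕ => ∑ k ∈ Finset.range n,
      (∫ u in (0 : ℝ)..θ, 2 * u ^ 2 * Real.sin (2 * k * u))) atTop (𝓝 I) := by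
    simp only [hint]
    simpa using tendsto_const_nhds.sub (tendsto_integral_cos_mul_of_continuousOn h0.le hg)
  have hS := (summable_div_nat_pow_of_abs_le_one (p := 2)
    (fun k => Real.abs_sin_le_one (k * (2 * θ))) (by norm_num)).hasSum.tendsto_sum_nat
  have hC := (summable_div_nat_pow_of_abs_le_one (p := 3)
    (fun k => Real.abs_cos_le_one (k * (2 * θ))) (by norm_num)).hasSum.tendsto_sum_nat
  have hZ := (summable_div_nat_pow_of_abs_le_one (p := 3) (f := fun _ => 1)
    (fun k => by simp) (by norm_num)).hasSum.tendsto_sum_nat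
  -- The sum of `cos (2 k θ) / k` is the only one whose convergence is not known beforehand: solve
  -- the closed forms of the integrals for it.
  have hlog : Tendsto (fun n => ∑ k ∈ Finset.range n, Real.cos (k * (2 * θ)) / k) atTop
      (𝓝 ((θ * ∑' k : ℕ, Real.sin (k * (2 * θ)) / (k : ℝ) ^ 2
        + (∑' k : ℕ, Real.cos (k * (2 * θ)) / (k : ℝ) ^ 3 - ∑' k : ℕ, 1 / (k : ℝ) ^ 3) / 2 - I)
          / θ ^ 2)) := by
    refine ((((hS.const_mul θ).add ((hC.sub hZ).div_const 2)).sub hlim).div_const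
      (θ ^ 2)).congr fun n => ?_
    simp only [integral_two_mul_sq_mul_sin, Finset.sum_add_distrib, Finset.sum_neg_distrib,
      ← Finset.mul_sum, ← Finset.sum_div, Finset.sum_sub_distrib]
    rw [div_eq_iff (by positivity)]
    ring
  have := eq_neg_log_of_tendsto_sum_cos_div (by linarith) (by linarith) hlog
  rw [mul_div_cancel_left₀ θ two_ne_zero, div_eq_iff (by positivity)] at this
  linarith

end

/-! ### Values at `π / 6` and `π / 4` -/

theorem hasSum_ite_dvd_one_div_cube {d : ℕ} (hd : d ≠ 0) :
    HasSum (fun k : ℕ => if d ∣ k then 1 / (k : ℝ) ^ 3 else 0)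
      ((∑' k : ℕ, 1 / (k : ℝ) ^ 3) / (d : ℝ) ^ 3) := by
  have hinj : Function.Injective fun k : ℕ => d * k := mul_right_injective₀ hd
  rw [← hinj.hasSum_iff]
  · have := (Real.summable_one_div_nat_pow.2 (show 1 < 3 by norm_num)).hasSum.div_const
      ((d : ℝ) ^ 3)
    refine this.congr_fun fun k => ?_
    simp only [Function.comp_apply, dvd_mul_right, if_true]
    push_cast
    rw [mul_pow, div_div, mul_comm]
  · intro k hk
    rw [if_neg]
    rintro ⟨m, rfl⟩
    exact hk ⟨m, rfl⟩

theorem cos_nat_mul_pi_div_three (k : ℕ) :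
    Real.cos (k * (Real.pi / 3)) = 1 / 2 - (if 2 ∣ k then 1 else 0)
      - 3 / 2 * (if 3 ∣ k then 1 else 0) + 3 * (if 6 ∣ k then 1 else 0) := by
  have hper : Real.cos (k * (Real.pi / 3)) = Real.cos ((k % 6 : ℕ) * (Real.pi / 3)) := by
    have hk : (k : ℝ) = 6 * (k / 6 : ℕ) + (k % 6 : ℕ) := by
      exact_mod_cast (Nat.div_add_mod k 6).symm
    rw [← Real.cos_add_nat_mul_two_pi ((k % 6 : ℕ) * (Real.pi / 3)) (k / 6), hk]
    congr 1
    ring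
  rw [hper]
  have h2 : 2 ∣ k ↔ 2 ∣ k % 6 := by omega
  have h3 : 3 ∣ k ↔ 3 ∣ k % 6 := by omega
  have h6 : 6 ∣ k ↔ 6 ∣ k % 6 := by omega
  simp only [h2, h3, h6]
  have hlt : k % 6 < 6 := Nat.mod_lt _ (by norm_num)
  have c2 : Real.cos (2 * (Real.pi / 3)) = -1 / 2 := by
    rw [Real.cos_two_mul, Real.cos_pi_div_three]; norm_num
  interval_cases k % 6
  · norm_num
  · norm_num
  · norm_num [c2]
  · norm_num [mul_div_cancel₀]
  · rw [show ((4 : ℕ) : ℝ) * (Real.pi / 3) = Real.pi / 3 + Real.pi by push_cast; ring,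
      Real.cos_add_pi]
    norm_num
  · rw [show ((5 : ℕ) : ℝ) * (Real.pi / 3) = 2 * Real.pi - Real.pi / 3 by push_cast; ring,
      Real.cos_two_pi_sub]
    norm_num

theorem cos_nat_mul_pi_div_two (k : ℕ) :
    Real.cos (k * (Real.pi / 2)) = 2 * (if 4 ∣ k then 1 else 0) - (if 2 ∣ k then 1 else 0) := by
  have hper : Real.cos (k * (Real.pi / 2)) = Real.cos ((k % 4 : ℕ) * (Real.pi / 2)) := by
    have hk : (k : ℝ) = 4 * (k / 4 : ℕ) + (k % 4 : ℕ) := by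
      exact_mod_cast (Nat.div_add_mod k 4).symm
    rw [← Real.cos_add_nat_mul_two_pi ((k % 4 : ℕ) * (Real.pi / 2)) (k / 4), hk]
    congr 1
    ring
  rw [hper]
  have h2 : 2 ∣ k ↔ 2 ∣ k % 4 := by omega
  have h4 : 4 ∣ k ↔ 4 ∣ k % 4 := by omega
  simp only [h2, h4]
  have hlt : k % 4 < 4 := Nat.mod_lt _ (by norm_num)
  interval_cases k % 4
  · norm_num
  · norm_num
  · norm_num [mul_div_cancel₀]
  · rw [show ((3 : ℕ) : ℝ) * (Real.pi / 2) = Real.pi / 2 + Real.pi by push_cast; ring,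
      Real.cos_add_pi]
    norm_num

theorem tsum_cos_nat_mul_pi_div_three_div_cube :
    ∑' k : ℕ, Real.cos (k * (Real.pi / 3)) / (k : ℝ) ^ 3 = (∑' k : ℕ, 1 / (k : ℝ) ^ 3) / 3 := by
  have h := ((((hasSum_ite_dvd_one_div_cube one_ne_zero).mul_left (1 / 2)).sub
    (hasSum_ite_dvd_one_div_cube two_ne_zero)).sub
    ((hasSum_ite_dvd_one_div_cube three_ne_zero).mul_left (3 / 2))).add
    ((hasSum_ite_dvd_one_div_cube (show 6 ≠ 0 by norm_num)).mul_left 3)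
  refine (h.congr_fun fun k => ?_).tsum_eq.trans ?_
  · rw [cos_nat_mul_pi_div_three]
    simp only [isUnit_one, IsUnit.dvd, if_true]
    split_ifs <;> ring
  · norm_num
    ring

theorem tsum_cos_nat_mul_pi_div_two_div_cube :
    ∑' k : ℕ, Real.cos (k * (Real.pi / 2)) / (k : ℝ) ^ 3
      = -(3 / 32) * ∑' k : ℕ, 1 / (k : ℝ) ^ 3 := by
  have h := ((hasSum_ite_dvd_one_div_cube four_ne_zero).mul_left 2).sub
    (hasSum_ite_dvd_one_div_cube two_ne_zero)
  refine (h.congr_fun fun k => ?_).tsum_eq.trans ?_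
  · rw [cos_nat_mul_pi_div_two]
    split_ifs <;> ring
  · norm_num
    ring

/-- Only odd `k` contribute. -/
theorem tsum_sin_nat_mul_pi_div_two_div_sq :
    ∑' k : ℕ, Real.sin (k * (Real.pi / 2)) / (k : ℝ) ^ 2 = catalanConstant := by
  have hinj : Function.Injective fun n : ℕ => 2 * n + 1 := fun a b h => by simpa using h
  rw [catalanConstant, ← hinj.tsum_eq]
  · refine tsum_congr fun n => ?_
    push_cast
    rw [show (2 * (n : ℝ) + 1) * (Real.pi / 2) = Real.pi / 2 + n * Real.pi by ring,
      Real.sin_add_nat_mul_pi, Real.sin_pi_div_two, mul_one]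
  · intro k hk
    by_contra hk'
    have hev : Even k := by
      by_contra ho
      obtain ⟨m, rfl⟩ := Nat.not_even_iff_odd.1 ho
      exact hk' ⟨m, rfl⟩
    obtain ⟨m, rfl⟩ := hev
    refine hk ?_
    push_cast
    rw [show ((m : ℝ) + m) * (Real.pi / 2) = m * Real.pi by ring, Real.sin_nat_mul_pi, zero_div]

theorem tsum_sin_nat_mul_div_sq (t : ℝ) :
    ∑' k : ℕ, Real.sin (k * t) / (k : ℝ) ^ 2 = clausenTwo t := by
  have hs := summable_div_nat_pow_of_abs_le_one (p := 2)
    (fun k => Real.abs_sin_le_one (k * t)) (by norm_num)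
  rw [clausenTwo, tsum_pnat_eq_tsum_succ (f := fun k : ℕ => Real.sin (k * t) / (k : ℝ) ^ 2),
    hs.tsum_eq_zero_add]
  simp

theorem riemannZeta_three_re : (riemannZeta 3).re = ∑' k : ℕ, 1 / (k : ℝ) ^ 3 := by
  have h := zeta_nat_eq_tsum_of_gt_one (show 1 < 3 by norm_num)
  have h' : riemannZeta 3 = ((∑' k : ℕ, 1 / (k : ℝ) ^ 3 : ℝ) : ℂ) := by
    push_cast
    exact_mod_cast h
  rw [h', Complex.ofReal_re]

/-- The case `θ = π / 6`, in which the logarithm vanishes. -/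
theorem hasSum_one_div_cube_mul_centralBinom :
    HasSum (fun n : ℕ => 1 / (((n : ℝ) + 1) ^ 3 * (Nat.centralBinom (n + 1) : ℝ)))
      (2 * Real.pi / 3 * clausenTwo (Real.pi / 3) - 4 / 3 * (riemannZeta 3).re) := by
  have hp := Real.pi_pos
  have h := hasSum_four_mul_sin_sq_pow_div (θ := Real.pi / 6)
    (by rw [abs_of_pos (by positivity)]; linarith)
  rw [integral_cos_mul_div_sinc (by positivity) (by linarith), Real.sin_pi_div_six,
    show 2 * (Real.pi / 6) = Real.pi / 3 by ring, tsum_sin_nat_mul_div_sq,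
    tsum_cos_nat_mul_pi_div_three_div_cube, ← riemannZeta_three_re] at h
  norm_num at h
  convert h using 1
  · ext n; norm_num
  · ring

/-- The case `θ = π / 4`. -/
theorem hasSum_two_pow_div_cube_mul_centralBinom :
    HasSum (fun n : ℕ => 2 ^ (n + 1) / (((n : ℝ) + 1) ^ 3 * (Nat.centralBinom (n + 1) : ℝ)))
      (Real.pi ^ 2 / 8 * Real.log 2 + Real.pi * catalanConstant
        - 35 / 16 * (riemannZeta 3).re) := by
  have hp := Real.pi_pos
  have h := hasSum_four_mul_sin_sq_pow_div (θ := Real.pi / 4)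
    (by rw [abs_of_pos (by positivity)]; linarith)
  rw [integral_cos_mul_div_sinc (by positivity) (by linarith), Real.sin_pi_div_four,
    show 2 * (Real.pi / 4) = Real.pi / 2 by ring, tsum_sin_nat_mul_pi_div_two_div_sq,
    tsum_cos_nat_mul_pi_div_two_div_cube, ← riemannZeta_three_re, mul_div_cancel₀ _ two_ne_zero,
    Real.log_sqrt two_pos.le, div_pow, Real.sq_sqrt two_pos.le] at h
  convert h using 1
  · norm_num
  · ring

/-! ### Summation of the double series along diagonals -/

theorem sum_antidiagonal_one_div_factorial_mul_factorial_succ (s : ℕ) :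
    ∑ p ∈ Finset.HasAntidiagonal.antidiagonal s, 1 / ((p.1 ! : ℝ) * ((p.2 + 1)! : ℝ))
      = (2 ^ (s + 1) - 1) / ((s + 1)! : ℝ) := by
  have hf : ((s + 1)! : ℝ) ≠ 0 := by positivity
  have hfull : ∑ p ∈ Finset.HasAntidiagonal.antidiagonal (s + 1), 1 / ((p.1 ! : ℝ) * (p.2 ! : ℝ))
      = 2 ^ (s + 1) / ((s + 1)! : ℝ) := by
    rw [eq_div_iff hf, Finset.sum_mul]
    have h2 : ∑ p ∈ Finset.HasAntidiagonal.antidiagonal (s + 1), ((s + 1).choose p.1 : ℝ)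
        = 2 ^ (s + 1) := by
      rw [Finset.Nat.sum_antidiagonal_eq_sum_range_succ_mk]
      exact_mod_cast Nat.sum_range_choose (s + 1)
    rw [← h2]
    refine Finset.sum_congr rfl fun p hp => ?_
    rw [← Finset.HasAntidiagonal.mem_antidiagonal.1 hp, Nat.cast_add_choose]
    ring
  rw [Finset.Nat.sum_antidiagonal_succ'] at hfull
  rw [sub_div, ← hfull]
  simp

/-- The general term with `k = m + 1`, as a factor depending only on `n + k` times `1 / (n! k!)`. -/
theorem gamma_term_eq (n m : ℕ) :
    1 / ((n ! : ℝ) * ((m + 1)! : ℝ)) * (1 / ((n : ℝ) + ((m + 1 : ℕ) : ℝ))) *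
        (Real.Gamma ((n : ℝ) + ((m + 1 : ℕ) : ℝ)) ^ 3 /
          Real.Gamma (2 * (n : ℝ) + 2 * ((m + 1 : ℕ) : ℝ)))
      = 2 * ((n + m + 1)! : ℝ) / (((n + m : ℕ) + 1 : ℝ) ^ 3 * (Nat.centralBinom (n + m + 1) : ℝ))
        * (1 / ((n ! : ℝ) * ((m + 1)! : ℝ))) := by
  generalize 1 / ((n ! : ℝ) * ((m + 1)! : ℝ)) = c
  obtain ⟨s, hs⟩ : ∃ s, s = n + m := ⟨_, rfl⟩
  rw [← hs, show (n : ℝ) + ((m + 1 : ℕ) : ℝ) = (s : ℝ) + 1 by rw [hs]; push_cast; ring,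
    show 2 * (n : ℝ) + 2 * ((m + 1 : ℕ) : ℝ) = ((2 * s + 1 : ℕ) : ℝ) + 1 by
      rw [hs]; push_cast; ring,
    Real.Gamma_nat_eq_factorial, Real.Gamma_nat_eq_factorial]
  have hb : ((s + 1)! : ℝ) * (s + 1)! * (Nat.centralBinom (s + 1) : ℝ) = ((2 * s + 2)! : ℝ) := by
    rw [Nat.centralBinom_eq_two_mul_choose, two_mul, Nat.cast_add_choose,
      show s + 1 + (s + 1) = 2 * s + 2 by ring]
    field_simp
  have h1 : ((s + 1)! : ℝ) = (s + 1) * (s ! : ℝ) := by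
    rw [Nat.factorial_succ]; push_cast; ring
  have h2 : ((2 * s + 2)! : ℝ) = (2 * s + 2) * ((2 * s + 1)! : ℝ) := by
    rw [Nat.factorial_succ]; push_cast; ring
  rw [h2, h1] at hb
  have h0 : (Nat.centralBinom (s + 1) : ℝ) ≠ 0 := by
    exact_mod_cast Nat.centralBinom_ne_zero (s + 1)
  have hs1 : (s : ℝ) + 1 ≠ 0 := by positivity
  rw [h1]
  have hb' : ((2 * s + 1)! : ℝ) = (s + 1) * (s ! : ℝ) ^ 2 * (Nat.centralBinom (s + 1) : ℝ) / 2 := by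
    field_simp
    refine mul_left_cancel₀ hs1 ?_
    linear_combination -hb
  rw [hb']
  field_simp

theorem mainTheorem5 :
    HasSum
      (fun p : ℕ × ℕ+ =>
        1 / (((p.1)! : ℝ) * ((p.2 : ℕ)! : ℝ)) * (1 / ((p.1 : ℝ) + (p.2 : ℝ))) *
          (Real.Gamma ((p.1 : ℝ) + (p.2 : ℝ)) ^ 3 /
            Real.Gamma (2 * (p.1 : ℝ) + 2 * (p.2 : ℝ))))
      (-(41 / 24) * (riemannZeta 3).re - 4 * Real.pi / 3 * clausenTwo (Real.pi / 3)
        + Real.pi ^ 2 / 4 * Real.log 2 + 2 * Real.pi * catalanConstant) := by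
  rw [← ((Equiv.refl ℕ).prodCongr Equiv.pnatEquivNat.symm).hasSum_iff,
    ← Finset.HasAntidiagonal.sigmaAntidiagonalEquivProd.hasSum_iff]
  -- `F ⟨s, (n, m)⟩` is the term with `k = m + 1`, so that `N = n + k = s + 1`.
  set F := fun q : Σ s : ℕ, Finset.HasAntidiagonal.antidiagonal s =>
    2 * ((q.1 + 1)! : ℝ) / (((q.1 : ℝ) + 1) ^ 3 * (Nat.centralBinom (q.1 + 1) : ℝ))
      * (1 / ((q.2.1.1 ! : ℝ) * ((q.2.1.2 + 1)! : ℝ))) with hF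
  have hfib : ∀ s, HasSum (fun c => F ⟨s, c⟩)
      (2 * (2 ^ (s + 1) / (((s : ℝ) + 1) ^ 3 * (Nat.centralBinom (s + 1) : ℝ))
        - 1 / (((s : ℝ) + 1) ^ 3 * (Nat.centralBinom (s + 1) : ℝ)))) := by
    intro s
    convert hasSum_fintype (fun c => F ⟨s, c⟩) using 1
    simp only [hF]
    rw [← Finset.mul_sum, Finset.univ_eq_attach,
      Finset.sum_attach (Finset.HasAntidiagonal.antidiagonal s)
      (fun p : ℕ × ℕ => 1 / ((p.1 ! : ℝ) * ((p.2 + 1)! : ℝ))),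
      sum_antidiagonal_one_div_factorial_mul_factorial_succ]
    have : ((s + 1)! : ℝ) ≠ 0 := by positivity
    field_simp
  have htot := (hasSum_two_pow_div_cube_mul_centralBinom.sub
    hasSum_one_div_cube_mul_centralBinom).mul_left 2
  have hsum : Summable F := by
    rw [summable_sigma_of_nonneg fun q => by simp only [hF]; positivity]
    exact ⟨fun s => (hfib s).summable, htot.summable.congr fun s => ((hfib s).tsum_eq).symm⟩
  have hval := hsum.hasSum.sigma hfib
  have heq := hval.unique htot
  convert hsum.hasSum using 1
  · ext ⟨s, ⟨⟨n, m⟩, hnm⟩⟩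
    obtain rfl := Finset.HasAntidiagonal.mem_antidiagonal.1 hnm
    exact gamma_term_eq n m
  · rw [heq]
    ring
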